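/- For a group $G$, a function $f:G\to\mathbb{C}$ and $u\in G$, let $\partial_u f:G\to\mathbb{C}$ be the left derivative $\partial_u f(x)=f(ux)-f(x)$. For an integer $k\ge 0$ let $P^k(G)$ be the complex vector space of all $f:G\to\mathbb{C}$ such that $\partial_{u_1}\cdots\partial_{u_{k+1}}f=0$ for all $u_1,\dots,u_{k+1}\in G$ (the polynomials of degree at most $k$ on $G$), and for $k<0$ let $P^k(G)=\{0\}$. Let $N$ be a finitely generated nilpotent group, let $H$ be a finite-index subgroup of $N$, and let $k$ be an integer. Then the restriction map $f\mapsto f|_H$, which is a linear map from functions $N\to\mathbb{C}$ to functions $H\to\mathbb{C}$, maps $P^k(N)$ bijectively onto $P^k(H)$; that is, restriction is a linear bijection from $P^k(N)$ onto $P^k(H)$. -/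

import Mathlib

namespace PolyOnGroup

/-- The left derivative `∂_u f (x) = f (u x) - f x`, as a linear operator on the
complex-valued functions on `G`. -/
def leftDeriv {G : Type*} [Group G] (u : G) : (G → ℂ) →ₗ[ℂ] (G → ℂ) where
  toFun f := fun x => f (u * x) - f x
  map_add' f g := by
    funext x
    simp only [Pi.add_apply]
    ring
  map_smul' c f := by
    funext x
    simp only [Pi.smul_apply, smul_eq_mul, RingHom.id_apply]
    ring

/-- The iterated left derivative `∂_{u₁} ⋯ ∂_{uₙ} f` along a list `[u₁, …, uₙ]`
(along the empty list it is `f` itself). -/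
def iterLeftDeriv {G : Type*} [Group G] : List G → ((G → ℂ) →ₗ[ℂ] (G → ℂ))
  | [] => LinearMap.id
  | u :: us => (leftDeriv u).comp (iterLeftDeriv us)

/-- The space `P^k(G)` of polynomials of degree at most `k` on `G`, for an integer `k`:
for `k ≥ 0` it consists of the `f : G → ℂ` all of whose `(k + 1)`-fold left derivatives vanish,
and for `k < 0` it is the zero space. -/
def polySpace (G : Type*) [Group G] (k : ℤ) : Submodule ℂ (G → ℂ) where
  carrier := {f |
    (0 ≤ k → ∀ us : List G, us.length = k.toNat + 1 → iterLeftDeriv us f = 0) ∧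
    (k < 0 → f = 0)}
  zero_mem' := ⟨fun _ _ _ => map_zero _, fun _ => rfl⟩
  add_mem' := by
    rintro f g ⟨hf, hf'⟩ ⟨hg, hg'⟩
    refine ⟨fun hk us hus => ?_, fun hk => ?_⟩
    · rw [map_add, hf hk us hus, hg hk us hus, add_zero]
    · rw [hf' hk, hg' hk, add_zero]
  smul_mem' := by
    rintro c f ⟨hf, hf'⟩
    refine ⟨fun hk us hus => ?_, fun hk => ?_⟩
    · rw [map_smul, hf hk us hus, smul_zero]
    · rw [hf' hk, smul_zero]

/-- Restriction of complex-valued functions on `N` to a subgroup `H`, as a linear map. -/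
def restrictLin {N : Type*} [Group N] (H : Subgroup N) : (N → ℂ) →ₗ[ℂ] (H → ℂ) where
  toFun f := fun h => f (h : N)
  map_add' _ _ := rfl
  map_smul' _ _ := rfl

end PolyOnGroup

/-! Finite index enters only through the fact that every element of `N` has a positive power in `H`.
Injectivity: a polynomial vanishing on the normal core of `H` is, by induction on degree, invariant
under that core. It is then constant, since polynomial growth along powers of `x` conflicts with
some power lying in the core. Surjectivity is a Malcev-type argument: `H` acts by left translation
on its polynomials of bounded degree, unipotently for the degree filtration. The group of unipotent
units is nilpotent with unique roots, so the action extends to `N`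
(`MonoidHom.exists_extension_of_unique_roots`). A matrix coefficient of the extended action is a
polynomial on `N` (`coeff_mem_polyLT`) restricting to the given one. -/

section

open scoped commutatorElement

/-! ### Isolators of subgroups in nilpotent groups -/

namespace Subgroup

/-- In a nilpotent group generated by `S`, a subgroup containing a positive power of every element
of `S` contains a positive power of every element. -/
theorem exists_pow_mem_of_lowerCentralSeries_eq_bot (n : ℕ) :
    ∀ {G : Type*} [Group G], (⊤ : Subgroup G).lowerCentralSeries (n + 1) = ⊥ →
      ∀ (Γ : Subgroup G) (S : Set G), closure S = ⊤ →
        (∀ s ∈ S, ∃ m, 0 < m ∧ s ^ m ∈ Γ) → ∀ g : G, ∃ m, 0 < m ∧ g ^ m ∈ Γ := by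
  induction n with
  | zero =>
    intro G _ hG Γ S hS hΓ g
    have hcomm : ∀ x y : G, Commute x y := by
      intro x y
      have h : ⁅x, y⁆ ∈ (⊤ : Subgroup G).lowerCentralSeries (0 + 1) := by
        rw [lowerCentralSeries_succ]
        exact commutator_mem_commutator (mem_top x) (mem_top y)
      rw [hG, mem_bot] at h
      exact commutatorElement_eq_one_iff_commute.1 h
    have hg : g ∈ closure S := hS ▸ mem_top g
    induction hg using closure_induction with
    | mem x hx => exact hΓ x hx
    | one => exact ⟨1, one_pos, by simp⟩
    | mul x y _ _ hx hy =>
      obtain ⟨a, ha, hxa⟩ := hx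
      obtain ⟨b, hb, hyb⟩ := hy
      refine ⟨a * b, Nat.mul_pos ha hb, ?_⟩
      rw [(hcomm x y).mul_pow, pow_mul, mul_comm a b, pow_mul y]
      exact mul_mem (pow_mem hxa b) (pow_mem hyb a)
    | inv x _ hx =>
      obtain ⟨a, ha, hxa⟩ := hx
      exact ⟨a, ha, by rw [inv_pow]; exact inv_mem hxa⟩
  | succ n ih =>
    intro G _ hG Γ S hS hΓ
    set K := (⊤ : Subgroup G).lowerCentralSeries (n + 1) with hK
    have hcen : ∀ z ∈ K, ∀ x, Commute z x := by
      intro z hz x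
      have h : ⁅z, x⁆ ∈ (⊤ : Subgroup G).lowerCentralSeries (n + 1 + 1) := by
        rw [lowerCentralSeries_succ]
        exact commutator_mem_commutator hz (mem_top x)
      rw [hG, mem_bot] at h
      exact commutatorElement_eq_one_iff_commute.1 h
    -- `K` is central, and `G ⧸ K` has smaller class, so the induction hypothesis applies there.
    have hquot : ∀ g : G, ∃ m, 0 < m ∧ ∃ γ ∈ Γ, ∃ z ∈ K, g ^ m = γ * z := by
      intro g
      have hmap : (⊤ : Subgroup (G ⧸ K)).lowerCentralSeries (n + 1) = ⊥ := by
        rw [← map_top_of_surjective (QuotientGroup.mk' K) (QuotientGroup.mk'_surjective K),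
          ← map_lowerCentralSeries, ← hK, QuotientGroup.map_mk'_self]
      obtain ⟨m, hm, γ, hγ, hgm⟩ := ih hmap (Γ.map (QuotientGroup.mk' K))
        (QuotientGroup.mk' K '' S)
        (by rw [← MonoidHom.map_closure, hS,
              map_top_of_surjective _ (QuotientGroup.mk'_surjective K)])
        (by
          rintro _ ⟨s, hs, rfl⟩
          obtain ⟨m, hm, hsm⟩ := hΓ s hs
          exact ⟨m, hm, s ^ m, hsm, map_pow _ _ _⟩)
        (QuotientGroup.mk' K g)
      refine ⟨m, hm, γ, hγ, γ⁻¹ * g ^ m, ?_, by group⟩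
      rw [← map_pow] at hgm
      exact QuotientGroup.eq.1 hgm
    let T : Subgroup G :=
      { carrier := {z | z ∈ center G ∧ ∃ m, 0 < m ∧ z ^ m ∈ Γ}
        one_mem' := ⟨one_mem _, 1, one_pos, by simp⟩
        mul_mem' := by
          rintro x y ⟨hx, a, ha, hxa⟩ ⟨hy, b, hb, hyb⟩
          refine ⟨mul_mem hx hy, a * b, Nat.mul_pos ha hb, ?_⟩
          have hxy : Commute x y := (mem_center_iff.1 hx y).symm
          rw [hxy.mul_pow, pow_mul, mul_comm a b, pow_mul y]
          exact mul_mem (pow_mem hxa b) (pow_mem hyb a)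
        inv_mem' := by
          rintro x ⟨hx, a, ha, hxa⟩
          exact ⟨inv_mem hx, a, ha, by rw [inv_pow]; exact inv_mem hxa⟩ }
    have hKT : K ≤ T := by
      rw [hK, lowerCentralSeries_succ]
      refine commutator_le.2 fun x hx s _ => ?_
      have hc : ⁅x, s⁆ ∈ K := by
        rw [hK, lowerCentralSeries_succ]
        exact commutator_mem_commutator hx (mem_top s)
      refine ⟨mem_center_iff.2 fun y => (hcen _ hc y).symm, ?_⟩
      obtain ⟨a, ha, γ, hγ, z, hz, hxa⟩ := hquot x
      obtain ⟨b, hb, δ, hδ, w, hw, hsb⟩ := hquot s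
      refine ⟨a * b, Nat.mul_pos ha hb, ?_⟩
      -- Commutators lying in the central `K` are multiplicative in each argument, so powers move
      -- inside; central factors then drop out, leaving a commutator of elements of `Γ`.
      have h1 : ⁅x, s⁆ ^ a = ⁅x ^ a, s⁆ := by
        have e : s * x⁻¹ * s⁻¹ = x⁻¹ * ⁅x, s⁆ := by rw [commutatorElement_def]; group
        have e' : ⁅x ^ a, s⁆ = x ^ a * (s * x⁻¹ * s⁻¹) ^ a := by
          rw [conj_pow, commutatorElement_def, inv_pow]; group
        rw [e', e, (hcen _ hc x⁻¹).symm.mul_pow, inv_pow, mul_inv_cancel_left]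
      have hca : ⁅x ^ a, s⁆ ∈ K := h1 ▸ pow_mem hc a
      have h2 : ⁅x ^ a, s⁆ ^ b = ⁅x ^ a, s ^ b⁆ := by
        have e : x ^ a * s * (x ^ a)⁻¹ = ⁅x ^ a, s⁆ * s := by
          rw [commutatorElement_def]; group
        have e' : ⁅x ^ a, s ^ b⁆ = (x ^ a * s * (x ^ a)⁻¹) ^ b * (s ^ b)⁻¹ := by
          rw [conj_pow, commutatorElement_def]
        rw [e', e, (hcen _ hca s).mul_pow, mul_inv_cancel_right]
      have h3 : ⁅γ * z, δ * w⁆ = ⁅γ, δ⁆ := by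
        have hz' := hcen z hz
        have hw' := hcen w hw
        calc ⁅γ * z, δ * w⁆ = γ * (z * (δ * w * z⁻¹)) * γ⁻¹ * (w⁻¹ * δ⁻¹) := by
              rw [commutatorElement_def]; group
          _ = γ * δ * (w * γ⁻¹) * (w⁻¹ * δ⁻¹) := by
              rw [(hz' (δ * w * z⁻¹)).eq]; group
          _ = ⁅γ, δ⁆ := by rw [(hw' γ⁻¹).eq, commutatorElement_def]; group
      rw [pow_mul, h1, h2, hxa, hsb, h3, commutatorElement_def]
      exact mul_mem (mul_mem (mul_mem hγ hδ) (inv_mem hγ)) (inv_mem hδ)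
    intro g
    obtain ⟨m, hm, γ, hγ, z, hz, hg⟩ := hquot g
    obtain ⟨-, r, hr, hzr⟩ := hKT hz
    refine ⟨m * r, Nat.mul_pos hm hr, ?_⟩
    rw [pow_mul, hg, (hcen z hz γ).symm.mul_pow]
    exact mul_mem (pow_mem hγ r) hzr

/-- In a nilpotent group, the elements having a positive power in a given subgroup are closed
under multiplication. -/
theorem exists_mul_pow_mem {G : Type*} [Group G] [Group.IsNilpotent G] (Γ : Subgroup G) {x y : G}
    (hx : ∃ m, 0 < m ∧ x ^ m ∈ Γ) (hy : ∃ m, 0 < m ∧ y ^ m ∈ Γ) :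
    ∃ m, 0 < m ∧ (x * y) ^ m ∈ Γ := by
  set S : Set G := {x | ∃ m, 0 < m ∧ x ^ m ∈ Γ}
  obtain ⟨n, hn⟩ := nilpotent_iff_lowerCentralSeries.1 (isNilpotent (closure S))
  have hn' : (⊤ : Subgroup (closure S)).lowerCentralSeries (n + 1) = ⊥ :=
    le_bot_iff.1 (hn ▸ lowerCentralSeries_antitone _ n.le_succ)
  obtain ⟨m, hm, h⟩ := exists_pow_mem_of_lowerCentralSeries_eq_bot n hn' (Γ.subgroupOf (closure S))
    (((↑) : closure S → G) ⁻¹' S) closure_closure_coe_preimage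
    (fun s ⟨m, hm, h⟩ => ⟨m, hm, h⟩)
    ⟨x * y, mul_mem (subset_closure hx) (subset_closure hy)⟩
  exact ⟨m, hm, h⟩

end Subgroup

/-- A homomorphism from `H` to a nilpotent group with unique roots extends to every nilpotent group
`N ≥ H` all of whose elements have a positive power in `H`. -/
theorem MonoidHom.exists_extension_of_unique_roots {N U : Type*} [Group N] [Group U]
    [Group.IsNilpotent N] [Group.IsNilpotent U] (H : Subgroup N)
    (hH : ∀ n : N, ∃ m, 0 < m ∧ n ^ m ∈ H)
    (hinj : ∀ m, 0 < m → ∀ a b : U, a ^ m = b ^ m → a = b)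
    (hsurj : ∀ m, 0 < m → ∀ c : U, ∃ b : U, b ^ m = c) (φ : H →* U) :
    ∃ ψ : N →* U, ∀ h : H, ψ h = φ h := by
  -- The graph of `φ`. The pairs with a positive power in it form the graph of the extension: unique
  -- roots make it single-valued, and nilpotency of `N × U` makes it closed under products.
  set Γ : Subgroup (N × U) := (H.subtype.prod φ).range with hΓ
  have huniq : ∀ (n : N) (u v : U), (∃ m, 0 < m ∧ (n, u) ^ m ∈ Γ) →
      (∃ m, 0 < m ∧ (n, v) ^ m ∈ Γ) → u = v := by
    rintro n u v ⟨a, ha, h, hu⟩ ⟨b, hb, h', hv⟩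
    simp only [MonoidHom.prod_apply, Subgroup.coe_subtype, Prod.pow_mk, Prod.mk.injEq] at hu hv
    refine hinj (a * b) (Nat.mul_pos ha hb) _ _ ?_
    have : h ^ b = h' ^ a := by
      ext
      rw [Subgroup.coe_pow, Subgroup.coe_pow, hu.1, hv.1, ← pow_mul, ← pow_mul, mul_comm]
    rw [pow_mul, ← hu.2, mul_comm, pow_mul, ← hv.2, ← map_pow, ← map_pow, this]
  have hex : ∀ n : N, ∃ u : U, ∃ m, 0 < m ∧ (n, u) ^ m ∈ Γ := by
    intro n
    obtain ⟨m, hm, h⟩ := hH n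
    obtain ⟨u, hu⟩ := hsurj m hm (φ ⟨n ^ m, h⟩)
    exact ⟨u, m, hm, ⟨n ^ m, h⟩, by simp [hu]⟩
  choose ψ hψ using hex
  refine ⟨MonoidHom.mk' ψ fun x y => huniq _ _ _ (hψ _) ?_, fun h => huniq _ _ _ (hψ _) ?_⟩
  · exact Γ.exists_mul_pow_mem (hψ x) (hψ y)
  · exact ⟨1, one_pos, h, by simp⟩

end

/-! ### Unipotent units of a filtered algebra: nilpotency and unique roots -/

/-- A finite descending multiplicative filtration of an algebra by subspaces; its terms of positive
index consist of nilpotent elements. -/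
structure NilpotentFiltration (K A : Type*) [Field K] [Ring A] [Algebra K A] where
  /-- The terms of the filtration. -/
  J : ℕ → Submodule K A
  /-- The index from which on the filtration vanishes. -/
  length : ℕ
  succ_le : ∀ i, J (i + 1) ≤ J i
  mul_mem_add : ∀ {i j x y}, x ∈ J i → y ∈ J j → x * y ∈ J (i + j)
  eq_bot : J length = ⊥

namespace NilpotentFiltration

variable {K A : Type*} [Field K] [Ring A] [Algebra K A] (F : NilpotentFiltration K A)

theorem antitone : Antitone F.J := antitone_nat_of_succ_le F.succ_le

theorem eq_zero_of_forall_mem {x : A} (h : ∀ i, x ∈ F.J (i + 1)) : x = 0 := by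
  have := F.succ_le _ (h F.length)
  rwa [F.eq_bot, Submodule.mem_bot] at this

theorem mul_sub_one_mem {i : ℕ} {a b : A} (ha : a - 1 ∈ F.J (i + 1)) (hb : b - 1 ∈ F.J (i + 1)) :
    a * b - 1 ∈ F.J (i + 1) := by
  have h : a * b - 1 = (a - 1) * (b - 1) + (a - 1) + (b - 1) := by noncomm_ring
  rw [h]
  exact add_mem (add_mem (F.antitone (by omega) (F.mul_mem_add ha hb)) ha) hb

theorem pow_sub_one_mem {a : A} (ha : a - 1 ∈ F.J 1) (m : ℕ) : a ^ m - 1 ∈ F.J 1 := by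
  induction m with
  | zero => simp
  | succ m ih => rw [pow_succ]; exact F.mul_sub_one_mem ih ha

/-- To first order, taking `m`-th powers multiplies differences by `m`. In characteristic zero this
yields both uniqueness and existence of roots. -/
theorem pow_sub_pow_sub_mem {i : ℕ} {a b : A} (ha : a - 1 ∈ F.J 1) (hb : b - 1 ∈ F.J 1)
    (hab : a - b ∈ F.J i) (m : ℕ) : a ^ m - b ^ m - (m : K) • (a - b) ∈ F.J (i + 1) := by
  induction m with
  | zero => simp
  | succ m ih =>
    have hm : a ^ m - b ^ m ∈ F.J i := by
      have := add_mem (F.succ_le i ih) (Submodule.smul_mem _ (m : K) hab)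
      rwa [sub_add_cancel] at this
    have h : a ^ (m + 1) - b ^ (m + 1) - ((m + 1 : ℕ) : K) • (a - b) =
        (a - 1) * (a ^ m - b ^ m) + (a - b) * (b ^ m - 1) +
          (a ^ m - b ^ m - (m : K) • (a - b)) := by
      rw [pow_succ' a, pow_succ' b, Nat.cast_succ, add_smul, one_smul]
      noncomm_ring
    rw [h]
    refine add_mem (add_mem ?_ ?_) ih
    · rw [add_comm]; exact F.mul_mem_add ha hm
    · exact F.mul_mem_add hab (F.pow_sub_one_mem hb m)

/-- The units congruent to `1`, together with their inverses, modulo a given term. -/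
def units (i : ℕ) : Subgroup Aˣ where
  carrier := {u | (u : A) - 1 ∈ F.J (i + 1) ∧ ((u⁻¹ : Aˣ) : A) - 1 ∈ F.J (i + 1)}
  one_mem' := by simp
  mul_mem' := by
    rintro u v ⟨hu, hu'⟩ ⟨hv, hv'⟩
    rw [Set.mem_ofPred_eq, mul_inv_rev, Units.val_mul, Units.val_mul]
    exact ⟨F.mul_sub_one_mem hu hv, F.mul_sub_one_mem hv' hu'⟩
  inv_mem' := by
    rintro u ⟨hu, hu'⟩
    rw [Set.mem_ofPred_eq, inv_inv]
    exact ⟨hu', hu⟩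

theorem commutator_sub_one_mem {i : ℕ} {u v : Aˣ} (hu : u ∈ F.units i) (hv : v ∈ F.units 0) :
    ((u * v * u⁻¹ * v⁻¹ : Aˣ) : A) - 1 ∈ F.J (i + 2) := by
  have hc : (u : A) * v - v * u ∈ F.J (i + 2) := by
    -- The additive commutator ignores the scalar parts, hence gains one filtration step.
    have h : (u : A) * v - v * u = (u - 1) * (v - 1) - (v - 1) * (u - 1) := by noncomm_ring
    rw [h]
    refine sub_mem (by simpa [add_assoc] using F.mul_mem_add hu.1 hv.1) ?_
    have := F.mul_mem_add hv.1 hu.1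
    rwa [show 0 + 1 + (i + 1) = i + 2 by omega] at this
  have hw : ((u⁻¹ * v⁻¹ : Aˣ) : A) - 1 ∈ F.J 1 := by
    rw [Units.val_mul]
    exact F.mul_sub_one_mem (F.antitone (by omega) hu.2) hv.2
  have h : ((u * v * u⁻¹ * v⁻¹ : Aˣ) : A) - 1 =
      ((u : A) * v - v * u) * (((u⁻¹ * v⁻¹ : Aˣ) : A) - 1) + ((u : A) * v - v * u) := by
    have e : (v : A) * u * (u⁻¹ * v⁻¹ : Aˣ) = 1 := by
      rw [← Units.val_mul, ← Units.val_mul, ← Units.val_one]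
      congr 1
      group
    rw [mul_sub, mul_one, sub_add_cancel, sub_mul, e, ← Units.val_mul, ← Units.val_mul]
    congr 2
    group
  rw [h]
  exact add_mem (F.succ_le _ (F.mul_mem_add hc hw)) hc

theorem commutator_mem_units {i : ℕ} {u v : Aˣ} (hu : u ∈ F.units i) (hv : v ∈ F.units 0) :
    u * v * u⁻¹ * v⁻¹ ∈ F.units (i + 1) := by
  refine ⟨F.commutator_sub_one_mem hu hv, ?_⟩
  have hw := F.commutator_sub_one_mem hu hv
  have hz : ((u * v * u⁻¹ * v⁻¹ : Aˣ)⁻¹ : Aˣ) ∈ F.units 0 := by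
    have hu0 : u ∈ F.units 0 := ⟨F.antitone (by omega) hu.1, F.antitone (by omega) hu.2⟩
    exact inv_mem (mul_mem (mul_mem (mul_mem hu0 hv) (inv_mem hu0))
      (inv_mem hv))
  set w : Aˣ := u * v * u⁻¹ * v⁻¹
  have h : ((w⁻¹ : Aˣ) : A) - 1 = -(((w : A) - 1) * (((w⁻¹ : Aˣ) : A) - 1) + ((w : A) - 1)) := by
    rw [mul_sub, mul_one, sub_add_cancel, sub_mul, one_mul, Units.mul_inv, neg_sub]
  rw [h]
  exact neg_mem (add_mem (F.succ_le _ (F.mul_mem_add hw hz.1)) hw)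

instance isNilpotent_units : Group.IsNilpotent (F.units 0) := by
  refine (Subgroup.nilpotent_iff_finite_descending_central_series _).2
    ⟨F.length, fun i => (F.units i).subgroupOf (F.units 0), ⟨Subgroup.subgroupOf_self _, ?_⟩, ?_⟩
  · rintro x i hx g
    exact F.commutator_mem_units hx g.2
  · refine (Subgroup.eq_bot_iff_forall _).2 fun x hx => Subtype.ext (Units.ext ?_)
    have := F.succ_le _ hx.1
    rw [F.eq_bot, Submodule.mem_bot, sub_eq_zero] at this
    exact this

variable [CharZero K]

theorem eq_of_pow_eq {m : ℕ} (hm : 0 < m) {a b : A} (ha : a - 1 ∈ F.J 1) (hb : b - 1 ∈ F.J 1)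
    (hab : a ^ m = b ^ m) : a = b := by
  refine sub_eq_zero.1 (F.eq_zero_of_forall_mem fun i => ?_)
  induction i with
  | zero =>
    rw [← sub_sub_sub_cancel_right a b 1]
    exact sub_mem ha hb
  | succ i ih =>
    have := F.pow_sub_pow_sub_mem ha hb ih m
    rw [hab, sub_self, zero_sub, Submodule.neg_mem_iff] at this
    exact (Submodule.smul_mem_iff _ (Nat.cast_ne_zero.2 hm.ne')).1 this

theorem exists_pow_eq {m : ℕ} (hm : 0 < m) {c : A} (hc : c - 1 ∈ F.J 1) :
    ∃ b, b - 1 ∈ F.J 1 ∧ b ^ m = c := by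
  have hm' : (m : K) ≠ 0 := Nat.cast_ne_zero.2 hm.ne'
  have key : ∀ i, ∃ b, b - 1 ∈ F.J 1 ∧ b ^ m - c ∈ F.J (i + 1) := by
    intro i
    induction i with
    | zero =>
      refine ⟨1, by simp, ?_⟩
      rw [one_pow, ← neg_sub]
      exact neg_mem hc
    | succ i ih =>
      obtain ⟨b, hb, hbc⟩ := ih
      have hd : (m : K)⁻¹ • (b ^ m - c) ∈ F.J (i + 1) := Submodule.smul_mem _ _ hbc
      set d := (m : K)⁻¹ • (b ^ m - c) with hd'
      have hb' : b - d - 1 ∈ F.J 1 := by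
        rw [sub_right_comm]
        exact sub_mem hb (F.antitone (by omega) hd)
      -- Newton correction with derivative `m`: the error moves one step deeper.
      refine ⟨b - d, hb', ?_⟩
      have := F.pow_sub_pow_sub_mem hb hb' (i := i + 1) (by rwa [sub_sub_cancel]) m
      rw [sub_sub_cancel, hd', smul_inv_smul₀ hm', ← hd'] at this
      rw [← Submodule.neg_mem_iff]
      convert this using 1
      abel
  obtain ⟨b, hb, h⟩ := key F.length
  refine ⟨b, hb, sub_eq_zero.1 ?_⟩
  have := F.succ_le _ h
  rwa [F.eq_bot, Submodule.mem_bot] at this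

theorem units_pow_injective {m : ℕ} (hm : 0 < m) (a b : F.units 0) (hab : a ^ m = b ^ m) :
    a = b := by
  refine Subtype.ext (Units.ext (F.eq_of_pow_eq hm a.2.1 b.2.1 ?_))
  have := congrArg (fun u : F.units 0 => ((u : Aˣ) : A)) hab
  simpa using this

theorem units_exists_pow_eq {m : ℕ} (hm : 0 < m) (c : F.units 0) : ∃ b : F.units 0, b ^ m = c := by
  obtain ⟨b, hb, hbc⟩ := F.exists_pow_eq hm c.2.1
  have hu : IsUnit b := (isUnit_pow_iff hm.ne').1 (hbc ▸ (c : Aˣ).isUnit)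
  obtain ⟨u, rfl⟩ := hu
  have hpow : u ^ m = (c : Aˣ) := Units.ext (by rw [Units.val_pow_eq_pow_val, hbc])
  have hinv : ((u⁻¹ : Aˣ) : A) - 1 ∈ F.J 1 := by
    obtain ⟨k, rfl⟩ := Nat.exists_eq_succ_of_ne_zero hm.ne'
    have h : (u⁻¹ : Aˣ) = u ^ k * (c : Aˣ)⁻¹ := by
      rw [← hpow, pow_succ, mul_inv_rev, ← inv_pow]
      group
    rw [h, Units.val_mul, Units.val_pow_eq_pow_val]
    exact F.mul_sub_one_mem (F.pow_sub_one_mem hb k) c.2.2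
  exact ⟨⟨u, hb, hinv⟩, Subtype.ext hpow⟩

end NilpotentFiltration

/-! ### Polynomials on groups and their derivatives -/

namespace PolyOnGroup

variable {G : Type*} [Group G]

theorem iterLeftDeriv_append_singleton (us : List G) (u : G) (f : G → ℂ) :
    iterLeftDeriv (us ++ [u]) f = iterLeftDeriv us (leftDeriv u f) := by
  induction us with
  | nil => rfl
  | cons v us ih => exact congrArg (leftDeriv v) ih

theorem mem_polySpace_of_nonneg {k : ℤ} (hk : 0 ≤ k) {f : G → ℂ} :
    f ∈ polySpace G k ↔ ∀ us : List G, us.length = k.toNat + 1 → iterLeftDeriv us f = 0 :=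
  ⟨fun h => h.1 hk, fun h => ⟨fun _ => h, fun h' => absurd hk h'.not_ge⟩⟩

theorem mem_polySpace_of_neg {k : ℤ} (hk : k < 0) {f : G → ℂ} : f ∈ polySpace G k ↔ f = 0 :=
  ⟨fun h => h.2 hk, fun h => ⟨fun h' => absurd hk h'.not_gt, fun _ => h⟩⟩

variable (G) in
/-- The polynomials of degree less than `n`. -/
def polyLT (n : ℕ) : Submodule ℂ (G → ℂ) := polySpace G ((n : ℤ) - 1)

@[simp]
theorem mem_polyLT_zero {f : G → ℂ} : f ∈ polyLT G 0 ↔ f = 0 := mem_polySpace_of_neg (by simp)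

theorem mem_polyLT_succ_iff {n : ℕ} {f : G → ℂ} :
    f ∈ polyLT G (n + 1) ↔ ∀ us : List G, us.length = n + 1 → iterLeftDeriv us f = 0 := by
  rw [polyLT, mem_polySpace_of_nonneg (by simp)]
  simp

theorem mem_polyLT_succ {n : ℕ} {f : G → ℂ} :
    f ∈ polyLT G (n + 1) ↔ ∀ u, leftDeriv u f ∈ polyLT G n := by
  rw [mem_polyLT_succ_iff]
  cases n with
  | zero =>
    refine ⟨fun h u => mem_polyLT_zero.2 (h [u] rfl), fun h us hus => ?_⟩
    obtain ⟨u, rfl⟩ := List.length_eq_one_iff.1 hus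
    exact mem_polyLT_zero.1 (h u)
  | succ n =>
    simp only [mem_polyLT_succ_iff]
    refine ⟨fun h u us hus => ?_, fun h us hus => ?_⟩
    · rw [← iterLeftDeriv_append_singleton]
      exact h _ (by simp [hus])
    · obtain rfl | ⟨us, u, rfl⟩ := us.eq_nil_or_concat
      · simp at hus
      · rw [List.concat_eq_append, iterLeftDeriv_append_singleton]
        exact h u us (by simpa using hus)

theorem polyLT_mono : Monotone (polyLT G) := by
  refine monotone_nat_of_le_succ fun n => ?_
  induction n with
  | zero =>
    intro f hf
    rw [mem_polyLT_zero.1 hf]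
    exact zero_mem _
  | succ n ih => exact fun f hf => mem_polyLT_succ.2 fun u => ih (mem_polyLT_succ.1 hf u)

theorem restrictLin_mem_polyLT (H : Subgroup G) {n : ℕ} {f : G → ℂ} (hf : f ∈ polyLT G n) :
    restrictLin H f ∈ polyLT H n := by
  induction n generalizing f with
  | zero => rw [mem_polyLT_zero.1 hf, map_zero]; exact zero_mem _
  | succ n ih => exact mem_polyLT_succ.2 fun u => ih (mem_polyLT_succ.1 hf u)

/-! ### Injectivity of restriction -/

/-- A polynomial that is invariant under a normal subgroup containing a positive power of every
element is constant. -/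
theorem eq_const_of_invariant (H : Subgroup G) [H.Normal] (hH : ∀ g : G, ∃ m, 0 < m ∧ g ^ m ∈ H)
    {n : ℕ} {f : G → ℂ} (hf : f ∈ polyLT G n) (hinv : ∀ h ∈ H, ∀ x, f (h * x) = f x) (x : G) :
    f x = f 1 := by
  induction n generalizing f x with
  | zero => rw [mem_polyLT_zero.1 hf]; rfl
  | succ n ih =>
    -- By normality the derivative along `x` is again invariant, hence constant by induction; so `f`
    -- is affine along powers of `x`.
    have hd : ∀ y, f (x * y) - f y = f (x * 1) - f 1 :=
      ih (mem_polyLT_succ.1 hf x) fun h hh y => by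
        rw [hinv h hh, ← hinv _ (‹H.Normal›.conj_mem h hh x) (x * y)]
        group
    have hpow : ∀ m : ℕ, f (x ^ m) = f 1 + m * (f x - f 1) := by
      intro m
      induction m with
      | zero => simp
      | succ m ihm =>
        have := hd (x ^ m)
        rw [← pow_succ', mul_one, ihm] at this
        push_cast
        linear_combination this
    obtain ⟨m, hm, h⟩ := hH x
    have h1 := hinv _ h 1
    rw [mul_one, hpow m, add_eq_left, mul_eq_zero, Nat.cast_eq_zero] at h1
    exact sub_eq_zero.1 (h1.resolve_left hm.ne')

theorem eq_zero_of_restrictLin_eq_zero (H : Subgroup G) [H.Normal]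
    (hH : ∀ g : G, ∃ m, 0 < m ∧ g ^ m ∈ H) {n : ℕ} {f : G → ℂ} (hf : f ∈ polyLT G n)
    (h0 : restrictLin H f = 0) : f = 0 := by
  induction n generalizing f with
  | zero => exact mem_polyLT_zero.1 hf
  | succ n ih =>
    have h0' : ∀ h ∈ H, f h = 0 := fun h hh => congrFun h0 ⟨h, hh⟩
    have hinv : ∀ h ∈ H, ∀ x, f (h * x) = f x := by
      intro h hh x
      refine sub_eq_zero.1 (congrFun (ih (mem_polyLT_succ.1 hf h) ?_) x)
      funext y
      change f (h * y) - f y = 0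
      rw [h0' _ (mul_mem hh y.2), h0' _ y.2, sub_zero]
    funext x
    rw [eq_const_of_invariant H hH hf hinv x, h0' 1 (one_mem H), Pi.zero_apply]

/-! ### Extension of polynomials via the translation action -/

/-- Left translation by `g⁻¹` differs from the identity by a left derivative, so it preserves
`polyLT G n`. -/
def translate (n : ℕ) : G →* Module.End ℂ (polyLT G n) where
  toFun g := LinearMap.restrict (leftDeriv g⁻¹ + LinearMap.id) fun f hf =>
    add_mem (mem_polyLT_succ.1 (polyLT_mono n.le_succ hf) g⁻¹) hf
  map_one' := by
    ext f x
    simp [LinearMap.restrict_apply, leftDeriv]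
  map_mul' g h := by
    ext f x
    simp [LinearMap.restrict_apply, leftDeriv, mul_assoc]

theorem translate_apply (n : ℕ) (g : G) (f : polyLT G n) (x : G) :
    (translate n g f : G → ℂ) x = (f : G → ℂ) (g⁻¹ * x) := by
  simp [translate, LinearMap.restrict_apply, leftDeriv]

variable (G) in
/-- The endomorphisms of `polyLT G n` filtered by the amount by which they lower the degree. -/
noncomputable def degreeFiltration (n : ℕ) : NilpotentFiltration ℂ (Module.End ℂ (polyLT G n)) where
  J i :=
    { carrier := {T | ∀ j (f : polyLT G n), (f : G → ℂ) ∈ polyLT G (j + i) →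
        (T f : G → ℂ) ∈ polyLT G j}
      zero_mem' := fun j f _ => zero_mem _
      add_mem' := fun hS hT j f hf => add_mem (hS j f hf) (hT j f hf)
      smul_mem' := fun c _ hT j f hf => Submodule.smul_mem _ c (hT j f hf) }
  length := n
  succ_le i T hT j f hf := hT j f (polyLT_mono (by omega) hf)
  mul_mem_add {i j S T} hS hT l f hf := hS l (T f) (hT (l + i) f (by rwa [add_assoc]))
  eq_bot := by
    refine (Submodule.eq_bot_iff _).2 fun T hT => LinearMap.ext fun f => Subtype.ext ?_
    exact mem_polyLT_zero.1 (hT 0 f (by rw [zero_add]; exact f.2))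

theorem translate_sub_one_mem (n : ℕ) (g : G) : translate n g - 1 ∈ (degreeFiltration G n).J 1 := by
  intro j f hf
  have h : ((translate n g - 1) f : polyLT G n) = leftDeriv g⁻¹ (f : G → ℂ) := by
    funext x
    simp [translate, LinearMap.restrict_apply]
  rw [h]
  exact mem_polyLT_succ.1 hf g⁻¹

variable (G) in
/-- Left translation as a homomorphism to the unipotent units. -/
noncomputable def translateUnits (n : ℕ) : G →* (degreeFiltration G n).units 0 :=
  (translate n).toHomUnits.codRestrict _ fun g =>
    ⟨translate_sub_one_mem n g, by
      rw [← map_inv]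
      exact translate_sub_one_mem n g⁻¹⟩

/-- A matrix coefficient of a representation that is unipotent for the degree filtration is a
polynomial. -/
theorem coeff_mem_polyLT {N : Type*} [Group N] {n : ℕ} (ψ : N →* (degreeFiltration G n).units 0)
    (x : G) {j : ℕ} (f : polyLT G n) (hf : (f : G → ℂ) ∈ polyLT G j) :
    (fun a : N => (((ψ a⁻¹ : (Module.End ℂ (polyLT G n))ˣ) : Module.End ℂ (polyLT G n)) f
      : G → ℂ) x) ∈ polyLT N j := by
  induction j generalizing f with
  | zero =>
    have : f = 0 := Subtype.ext (mem_polyLT_zero.1 hf)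
    subst this
    simp only [map_zero]
    exact zero_mem _
  | succ j ih =>
    refine mem_polyLT_succ.2 fun u => ?_
    -- Deriving the coefficient along `u` replaces `f` by `(ψ u⁻¹ - 1) f`, which has lower degree.
    have h1 := (ψ u⁻¹).2.1 j f hf
    convert ih _ h1 using 1
    funext a
    simp [leftDeriv]

theorem exists_restrictLin_eq {N : Type*} [Group N] [Group.IsNilpotent N] (H : Subgroup N)
    (hH : ∀ g : N, ∃ m, 0 < m ∧ g ^ m ∈ H) {n : ℕ} {f : H → ℂ} (hf : f ∈ polyLT H n) :
    ∃ F ∈ polyLT N n, restrictLin H F = f := by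
  obtain ⟨ψ, hψ⟩ := MonoidHom.exists_extension_of_unique_roots H hH
    (fun m hm => (degreeFiltration H n).units_pow_injective hm)
    (fun m hm => (degreeFiltration H n).units_exists_pow_eq hm) (translateUnits H n)
  refine ⟨_, coeff_mem_polyLT ψ 1 ⟨f, hf⟩ hf, ?_⟩
  funext h
  have : ψ (h : N)⁻¹ = translateUnits H n h⁻¹ := hψ h⁻¹
  change (((ψ (h : N)⁻¹ : (Module.End ℂ (polyLT H n))ˣ) : Module.End ℂ (polyLT H n)) ⟨f, hf⟩
    : H → ℂ) 1 = f h
  rw [this]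
  refine (translate_apply n h⁻¹ ⟨f, hf⟩ 1).trans ?_
  simp

theorem bijOn_restrictLin_polyLT {N : Type*} [Group N] [Group.IsNilpotent N] (H : Subgroup N)
    [H.FiniteIndex] (n : ℕ) :
    Set.BijOn (restrictLin H) (polyLT N n : Set (N → ℂ)) (polyLT H n : Set (H → ℂ)) := by
  have hpow : ∀ K : Subgroup N, K.FiniteIndex → ∀ g : N, ∃ m, 0 < m ∧ g ^ m ∈ K := by
    intro K hK g
    obtain ⟨m, hm, -, h⟩ := Subgroup.exists_pow_mem_of_index_ne_zero hK.index_ne_zero g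
    exact ⟨m, hm, h⟩
  refine ⟨fun f hf => restrictLin_mem_polyLT H hf, fun f hf g hg hfg => ?_, fun f hf => ?_⟩
  -- The vanishing lemma needs normality; the normal core still has finite index.
  · refine sub_eq_zero.1 (eq_zero_of_restrictLin_eq_zero H.normalCore (hpow _ inferInstance)
      (sub_mem hf hg) ?_)
    funext x
    exact sub_eq_zero.2 (congrFun hfg ⟨x, H.normalCore_le x.2⟩)
  · exact exists_restrictLin_eq H (hpow H inferInstance) hf

end PolyOnGroup

theorem mainTheorem11 {N : Type*} [Group N] [Group.FG N] [Group.IsNilpotent N]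
    (H : Subgroup N) [H.FiniteIndex] (k : ℤ) :
    Set.BijOn (PolyOnGroup.restrictLin H)
      (PolyOnGroup.polySpace N k : Set (N → ℂ))
      (PolyOnGroup.polySpace H k : Set (H → ℂ)) := by
  rcases lt_or_ge k 0 with hk | hk
  · have h := PolyOnGroup.bijOn_restrictLin_polyLT H 0
    have e : ∀ (G : Type _) [Group G], PolyOnGroup.polySpace G k = PolyOnGroup.polyLT G 0 :=
      fun G _ => SetLike.ext fun f => by
        rw [PolyOnGroup.mem_polySpace_of_neg hk, PolyOnGroup.mem_polyLT_zero]
    rwa [e N, e H]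
  · have h := PolyOnGroup.bijOn_restrictLin_polyLT H (k.toNat + 1)
    have e : ((k.toNat + 1 : ℕ) : ℤ) - 1 = k := by omega
    rwa [PolyOnGroup.polyLT, PolyOnGroup.polyLT, e] at h
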